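/- Let $\gamma$ be Euler's constant and let the Stieltjes constants $\gamma_m$ be defined by the Laurent expansion $$\zeta(s)=\frac1{s-1}+\sum_{m=0}^\infty\frac{(-1)^m(s-1)^m}{m!}\,\gamma_m\qquad(s\neq1).$$ Let $B_n$ be the Bernoulli numbers ($B_2=\tfrac16$, $B_4=-\tfrac1{30}$, …), and put $H_n=\sum_{k=1}^n\frac1k$, $H_n^{(r)}=\sum_{k=1}^n\frac1{k^r}$. Then for every integer $N\ge1$ there are numbers $\theta_0,\theta_1,\theta_2,\theta_3\in(0,1)$, depending on $N$, such that $$\gamma=\frac12\left\{1+\sum_{k=1}^N\frac{B_{2k}}{k}+\theta_0\,\frac{B_{2N+2}}{N+1}\right\},$$ $$\gamma_1=-\frac12\sum_{k=1}^N\frac{B_{2k}H_{2k-1}}{k}-\theta_1\,\frac{B_{2N+2}H_{2N+1}}{2N+2},$$ $$\gamma_2=\frac12\sum_{k=1}^N\frac{B_{2k}\{H_{2k-1}^2-H_{2k-1}^{(2)}\}}{k}+\theta_2\,\frac{B_{2N+2}\{H_{2N+1}^2-H_{2N+1}^{(2)}\}}{2N+2},$$ $$\gamma_3=-\frac12\sum_{k=1}^N\frac{B_{2k}\{H_{2k-1}^3-3H_{2k-1}H_{2k-1}^{(2)}+2H_{2k-1}^{(3)}\}}{k}-\theta_3\,\frac{B_{2N+2}\{H_{2N+1}^3-3H_{2N+1}H_{2N+1}^{(2)}+2H_{2N+1}^{(3)}\}}{2N+2}.$$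 The formulas for $\gamma$ and $\gamma_1$ also hold for $N=0$ (with empty sums). -/

import Mathlib

open Filter Topology Finset

noncomputable section

/-- The regular part `ζ(s) - 1/(s-1)` of the Riemann zeta function at its simple pole `s = 1`, with
the singularity at `s = 1` removed: the value there is the limit of `ζ(s) - 1/(s-1)`. -/
def zetaRegularPart : ℂ → ℂ :=
  Function.update (fun s : ℂ => riemannZeta s - 1 / (s - 1)) 1
    (limUnder (𝓝[≠] (1 : ℂ)) (fun s : ℂ => riemannZeta s - 1 / (s - 1)))

/-- The `m`-th Stieltjes constant `γ_m`, defined by the Laurent expansion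
`ζ(s) = 1/(s-1) + ∑ (-1)^m (s-1)^m / m! * γ_m` at `s = 1`: the Taylor coefficient of order `m`
of the regular part is `(-1)^m γ_m / m!`, that is, its `m`-th derivative at `1` is `(-1)^m γ_m`.
See `hasSum_stieltjesConst` for the expansion itself. -/
def stieltjesConst (m : ℕ) : ℂ :=
  (-1) ^ m * iteratedDeriv m zetaRegularPart 1

/-- The generalized harmonic number `H_n^{(r)} = ∑_{k=1}^n 1/k^r`. -/
def genHarmonic (r n : ℕ) : ℚ :=
  ∑ k ∈ Finset.Icc 1 n, 1 / (k : ℚ) ^ r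

end

theorem differentiable_zetaRegularPart : Differentiable ℂ zetaRegularPart := by
  have hd : ∀ s : ℂ, s ≠ 1 →
      DifferentiableAt ℂ (fun s : ℂ => riemannZeta s - 1 / (s - 1)) s := fun s hs =>
    (differentiableAt_riemannZeta hs).sub
      ((differentiableAt_const _).div (by fun_prop) (sub_ne_zero.mpr hs))
  have hu : ∀ s : ℂ, s ≠ 1 → DifferentiableAt ℂ zetaRegularPart s := fun s hs => by
    refine (hd s hs).congr_of_eventuallyEq ?_
    filter_upwards [isOpen_ne.mem_nhds hs] with t ht
    exact Function.update_of_ne ht _ _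
  intro s
  by_cases hs : s = 1
  · subst hs
    refine (Complex.analyticAt_of_differentiable_on_punctured_nhds_of_continuousAt
      ?_ ?_).differentiableAt
    · filter_upwards [self_mem_nhdsWithin] with t ht using hu t ht
    · rw [zetaRegularPart, continuousAt_update_same, tendsto_riemannZeta_sub_one_div.limUnder_eq]
      exact tendsto_riemannZeta_sub_one_div
  · exact hu s hs

/-- The Laurent expansion of the zeta function at `s = 1` that defines the Stieltjes constants. -/
theorem hasSum_stieltjesConst (s : ℂ) (hs : s ≠ 1) :
    HasSum (fun m : ℕ => (-1) ^ m * (s - 1) ^ m / (m.factorial : ℂ) * stieltjesConst m)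
      (riemannZeta s - 1 / (s - 1)) := by
  have h := Complex.hasSum_taylorSeries_of_entire differentiable_zetaRegularPart 1 s
  have he : zetaRegularPart s = riemannZeta s - 1 / (s - 1) := Function.update_of_ne hs _ _
  rw [he] at h
  refine h.congr_fun ?_
  intro m
  have h1 : ((-1 : ℂ) ^ m) * (-1) ^ m = 1 := by rw [← mul_pow]; simp
  simp only [stieltjesConst, smul_eq_mul]
  linear_combination (s - 1) ^ m / (m.factorial : ℂ) * iteratedDeriv m zetaRegularPart 1 * h1

/-! The four formulas are one statement about partial sums. Put `x` equal to `γ - 1/2`, `-γ_1`,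
`γ_2`, `-γ_3` and `Q n` equal to `j!` times the elementary symmetric function `e_j(1, 1/2, …, 1/n)`,
`j = 0, 1, 2, 3`. Each formula says that `x` lies strictly between the consecutive partial sums
`S_N` and `S_{N+1}` of the alternating series `∑ (-1)^(k+1) c_k`, where `c_k = |B_{2k}| / (2k) * Q
(2k-1)`.

The series diverges, and this helps: `|B_{2k}| / (2k)` increases from `k = 3` on
(`bernoulliRatio_le_succ`, from the values `ζ(2k)`) and `Q` is monotone. So the even partial sums
decrease weakly from `S_2`, the odd ones increase weakly from `S_3`, and `S_2 < x < S_3` propagates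
to all later `N` (`alternating_sum_bounds`). Together with `x < S_1` this settles every `N ≥ 1`; `N
= 0` needs `0 < x` as well, which holds only for `γ` and `γ_1`. What remains is a finite numerical
check for each constant.

The numerics come from Euler–Maclaurin summation of `ζ` with an explicit error. Multiplied by `s -
1`, the approximations are entire and their increments are summable near `s = 1`, which carries the
error estimate to the circle `|s - 1| = 1` (`norm_sub_emSum_le`). Cauchy's estimate then bounds the
derivatives at `1`, and 8 terms of the zeta series suffice. -/

/-! ### Euler–Maclaurin increments -/

/-- `s - 1` times the Euler–Maclaurin approximation of `ζ(s) - 1 / (s - 1)` by the first `n` terms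
of the zeta series and one derivative correction; it is an entire function of `s`. -/
noncomputable def emSum (n : ℕ) (s : ℂ) : ℂ :=
  (s - 1) * (∑ k ∈ range n, ((k + 1 : ℕ) : ℂ) ^ (-s) - (n : ℂ) ^ (-s) / 2
    + s * (n : ℂ) ^ (-s - 1) / 12) + (n : ℂ) ^ (1 - s) - 1

theorem hasDerivAt_ofReal_cpow_neg_sub {x : ℝ} (hx : 0 < x) (s : ℂ) (j : ℂ) :
    HasDerivAt (fun y : ℝ => (y : ℂ) ^ (-s - j)) ((-s - j) * (x : ℂ) ^ (-s - (j + 1))) x := by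
  have h := (hasDerivAt_id (x : ℂ)).cpow_const (c := -s - j) (Or.inl (by simpa using hx))
  have h2 := h.comp_ofReal
  simp only [id, mul_one] at h2
  convert h2 using 3
  ring

/-- The Euler–Maclaurin primitive: its derivative is `(s - 1) * K * f⁗` with `f x = x ^ (-s)` and
`K x = (x - a) ^ 2 * (a + 1 - x) ^ 2`. -/
theorem hasDerivAt_emPrimitive (s : ℂ) (a : ℝ) {x : ℝ} (hx : 0 < x) :
    HasDerivAt (fun y : ℝ => (s - 1) * (((y : ℂ) - a) ^ 2 * (a + 1 - y) ^ 2 *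
        (-(s * (s + 1) * (s + 2)) * (y : ℂ) ^ (-s - 3))
        - (2 * (y - a) - 6 * (y - a) ^ 2 + 4 * (y - a) ^ 3) * (s * (s + 1) * (y : ℂ) ^ (-s - 2))
        + (2 - 12 * (y - a) + 12 * (y - a) ^ 2) * (-s * (y : ℂ) ^ (-s - 1))
        - (24 * (y - a) - 12) * (y : ℂ) ^ (-s - 0)) - 24 * (y : ℂ) ^ (-s - (-1)))
      ((s - 1) * (((x : ℂ) - a) ^ 2 * (a + 1 - x) ^ 2 *
        (s * (s + 1) * (s + 2) * (s + 3) * (x : ℂ) ^ (-s - 4)))) x := by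
  have h3 := hasDerivAt_ofReal_cpow_neg_sub hx s 3
  have h2 := hasDerivAt_ofReal_cpow_neg_sub hx s 2
  have h1 := hasDerivAt_ofReal_cpow_neg_sub hx s 1
  have h0 := hasDerivAt_ofReal_cpow_neg_sub hx s 0
  have hm := hasDerivAt_ofReal_cpow_neg_sub hx s (-1)
  rw [show (3 : ℂ) + 1 = 4 by norm_num] at h3
  rw [show (2 : ℂ) + 1 = 3 by norm_num] at h2
  rw [show (1 : ℂ) + 1 = 2 by norm_num] at h1
  rw [show (0 : ℂ) + 1 = 1 by norm_num] at h0
  rw [show (-1 : ℂ) + 1 = 0 by norm_num] at hm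
  have hy : HasDerivAt (fun y : ℝ => (y : ℂ) - a) 1 x :=
    (Complex.ofRealCLM.hasDerivAt (x := x)).sub_const _
  have hz : HasDerivAt (fun y : ℝ => (a : ℂ) + 1 - y) (-1) x :=
    (Complex.ofRealCLM.hasDerivAt (x := x)).const_sub _
  have hp := ((((((hy.fun_pow 2).fun_mul (hz.fun_pow 2)).fun_mul
    (h3.const_mul (-(s * (s + 1) * (s + 2))))).fun_sub
    ((((hy.const_mul 2).fun_sub ((hy.fun_pow 2).const_mul 6)).fun_add
      ((hy.fun_pow 3).const_mul 4)).fun_mul (h2.const_mul (s * (s + 1))))).fun_add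
    ((((hy.const_mul 12).const_sub 2).fun_add ((hy.fun_pow 2).const_mul 12)).fun_mul
      (h1.const_mul (-s)))).fun_sub
    (((hy.const_mul 24).sub_const 12).fun_mul h0)).const_mul (s - 1) |>.fun_sub (hm.const_mul 24)
  refine hp.congr_deriv ?_
  push_cast
  ring

/-- Integrate `K * f⁗` by parts four times over `[n, n + 1]`. The kernel `K` vanishes to second
order at both ends, where `K'' = 2` and `K''' = ∓12`, and `K'''' = 24`, so up to sign the result is
24 times the increment. As `∫ K = 1/30`, the constant is `1 / (24 * 30)`. The condition on `s.re`
makes `|x ^ (-s - 4)|` largest at `x = n`. -/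
theorem norm_emSum_succ_sub_le {n : ℕ} (hn : 0 < n) {s : ℂ} (hs : -4 ≤ s.re) :
    ‖emSum (n + 1) s - emSum n s‖ ≤
      ‖(s - 1) * (s * (s + 1) * (s + 2) * (s + 3))‖ / 720 * (n : ℝ) ^ (-s.re - 4) := by
  set C : ℝ := ‖(s - 1) * (s * (s + 1) * (s + 2) * (s + 3))‖ * (n : ℝ) ^ (-s.re - 4) with hC
  have hn' : (0 : ℝ) < n := by exact_mod_cast hn
  set Φ : ℝ → ℂ := fun y : ℝ => (s - 1) * (((y : ℂ) - (n : ℝ)) ^ 2 * ((n : ℝ) + 1 - y) ^ 2 *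
        (-(s * (s + 1) * (s + 2)) * (y : ℂ) ^ (-s - 3))
        - (2 * (y - (n : ℝ)) - 6 * (y - (n : ℝ)) ^ 2 + 4 * (y - (n : ℝ)) ^ 3) *
          (s * (s + 1) * (y : ℂ) ^ (-s - 2))
        + (2 - 12 * (y - (n : ℝ)) + 12 * (y - (n : ℝ)) ^ 2) * (-s * (y : ℂ) ^ (-s - 1))
        - (24 * (y - (n : ℝ)) - 12) * (y : ℂ) ^ (-s - 0)) - 24 * (y : ℂ) ^ (-s - (-1)) with hΦ
  have hd : ∀ x : ℝ, 0 < x → HasDerivAt Φ _ x := fun x hx => hasDerivAt_emPrimitive s n hx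
  -- The explicit primitive of `C * K`, used as the bounding function in the mean value inequality;
  -- it grows by `C / 30` over the interval.
  have hB : ∀ x : ℝ, HasDerivAt (fun x : ℝ => C * ((x - n) ^ 3 / 3 - (x - n) ^ 4 / 2
      + (x - n) ^ 5 / 5)) (C * ((x - n) ^ 2 * (n + 1 - x) ^ 2)) x := fun x => by
    have hy : HasDerivAt (fun y : ℝ => y - n) 1 x := (hasDerivAt_id x).sub_const _
    have := (((hy.fun_pow 3).div_const 3).fun_sub ((hy.fun_pow 4).div_const 2)).fun_add
      ((hy.fun_pow 5).div_const 5) |>.const_mul C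
    refine this.congr_deriv ?_
    push_cast
    ring
  have key := image_norm_le_of_norm_deriv_right_le_deriv_boundary
    (f := fun x => Φ x - Φ n) (a := n) (b := n + 1)
    (f' := fun x : ℝ => (s - 1) * (((x : ℂ) - (n : ℝ)) ^ 2 * ((n : ℝ) + 1 - x) ^ 2 *
        (s * (s + 1) * (s + 2) * (s + 3) * (x : ℂ) ^ (-s - 4))))
    (fun x hx => ((hd x (hn'.trans_le hx.1)).sub_const _).continuousAt.continuousWithinAt)
    (fun x hx => ((hd x (hn'.trans_le hx.1)).sub_const _).hasDerivWithinAt)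
    (by simp) hB (fun x hx => by
      have hx0 : 0 < x := hn'.trans_le hx.1
      have e : (s - 1) * (((x : ℂ) - (n : ℝ)) ^ 2 * ((n : ℝ) + 1 - x) ^ 2 *
          (s * (s + 1) * (s + 2) * (s + 3) * (x : ℂ) ^ (-s - 4))) =
          ((s - 1) * (s * (s + 1) * (s + 2) * (s + 3))) *
          ((((x - n) ^ 2 * (n + 1 - x) ^ 2 : ℝ) : ℂ) * (x : ℂ) ^ (-s - 4)) := by
        push_cast; ring
      rw [e, norm_mul, norm_mul (Complex.ofReal _), Complex.norm_cpow_eq_rpow_re_of_pos hx0, Complex.norm_real,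
        Real.norm_of_nonneg (by positivity), hC]
      have h4 : (-s - 4).re = -s.re - 4 := by simp
      rw [h4]
      have := Real.rpow_le_rpow_of_nonpos hn' hx.1 (by linarith : -s.re - 4 ≤ 0)
      calc _ ≤ ‖(s - 1) * (s * (s + 1) * (s + 2) * (s + 3))‖ *
            ((x - n) ^ 2 * (n + 1 - x) ^ 2 * (n : ℝ) ^ (-s.re - 4)) := by gcongr
        _ = _ := by ring)
    (x := n + 1) ⟨by linarith, le_rfl⟩
  have e : Φ (n + 1) - Φ n = -24 * (emSum (n + 1) s - emSum n s) := by
    simp only [hΦ, emSum, sum_range_succ]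
    push_cast
    rw [show -s - 0 = -s by ring, show -s - (-1) = 1 - s by ring]
    ring
  have e2 : ‖Φ (n + 1) - Φ n‖ = 24 * ‖emSum (n + 1) s - emSum n s‖ := by
    rw [e, norm_mul]; norm_num
  rw [e2] at key
  rw [hC] at key
  ring_nf at key ⊢
  linarith

theorem differentiable_emSum {n : ℕ} (hn : 0 < n) : Differentiable ℂ (emSum n) := by
  have h0 : ∀ k : ℕ, 0 < k → ∀ g : ℂ → ℂ, Differentiable ℂ g →
      Differentiable ℂ fun s => (k : ℂ) ^ g s := fun k hk g hg =>
    hg.const_cpow (Or.inl (by exact_mod_cast hk.ne'))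
  have h1 := h0 n hn (fun s => -s) (by fun_prop)
  have h2 := h0 n hn (fun s => -s - 1) (by fun_prop)
  have h3 := h0 n hn (fun s => 1 - s) (by fun_prop)
  have h4 : Differentiable ℂ fun s : ℂ => ∑ k ∈ range n, ((k + 1 : ℕ) : ℂ) ^ (-s) :=
    Differentiable.fun_sum fun k _ => h0 (k + 1) k.succ_pos _ (by fun_prop)
  unfold emSum
  fun_prop

/-! ### Convergence to zeta and continuation past the line `Re s = 1` -/

theorem tendsto_natCast_cpow_zero {r : ℂ} (hr : r.re < 0) :
    Tendsto (fun n : ℕ => (n : ℂ) ^ r) atTop (𝓝 0) := by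
  rw [tendsto_zero_iff_norm_tendsto_zero]
  have h := (tendsto_rpow_neg_atTop (y := -r.re) (by linarith)).comp
    (tendsto_natCast_atTop_atTop (R := ℝ))
  refine h.congr' ?_
  filter_upwards [eventually_gt_atTop 0] with n hn
  simp [Complex.norm_natCast_cpow_of_pos hn]

theorem tendsto_emSum {s : ℂ} (hs : 1 < s.re) :
    Tendsto (fun n => emSum n s) atTop (𝓝 ((s - 1) * zetaRegularPart s)) := by
  have hs1 : s ≠ 1 := by rintro rfl; simp at hs
  have hz : (s - 1) * zetaRegularPart s = (s - 1) * riemannZeta s - 1 := by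
    rw [zetaRegularPart, Function.update_of_ne hs1]
    field_simp [sub_ne_zero.mpr hs1]
  have hsum : Tendsto (fun n => ∑ k ∈ range n, ((k + 1 : ℕ) : ℂ) ^ (-s)) atTop
      (𝓝 (riemannZeta s)) := by
    have hsm : Summable fun k : ℕ => 1 / ((k : ℂ) + 1) ^ s := by
      have := (summable_nat_add_iff 1).mpr (Complex.summable_one_div_nat_cpow.mpr hs)
      simpa using this
    rw [zeta_eq_tsum_one_div_nat_add_one_cpow hs]
    refine hsm.hasSum.tendsto_sum_nat.congr fun n => sum_congr rfl fun k _ => ?_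
    simp [Complex.cpow_neg]
  have h1 := tendsto_natCast_cpow_zero (r := -s) (by simp; linarith)
  have h2 := tendsto_natCast_cpow_zero (r := -s - 1) (by simp; linarith)
  have h3 := tendsto_natCast_cpow_zero (r := 1 - s) (by simp; linarith)
  have := (((hsum.sub (h1.div_const 2)).add ((h2.const_mul s).div_const 12)).const_mul (s - 1)
    |>.add h3).sub_const 1
  rw [hz]
  simpa [emSum] using this

/-- The increments are dominated uniformly on the ball by a convergent series, so their sum is
analytic there. It telescopes to the right-hand side where `Re s > 1`, and the identity theorem
extends this to the whole ball. -/
theorem hasSum_emSum_succ_sub {a : ℕ} (ha : 0 < a) {s : ℂ} (hs : s ∈ Metric.ball (1 : ℂ) 2) :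
    HasSum (fun n => emSum (n + a + 1) s - emSum (n + a) s)
      ((s - 1) * zetaRegularPart s - emSum a s) := by
  have hre : ∀ w ∈ Metric.ball (1 : ℂ) 2, -1 < w.re := fun w hw => by
    have h1 : |(w - 1).re| < 2 :=
      (Complex.abs_re_le_norm _).trans_lt (by simpa [dist_eq_norm] using hw)
    have := (abs_lt.mp h1).1
    simp at this; linarith
  have hle : ∀ (n : ℕ), ∀ w ∈ Metric.ball (1 : ℂ) 2,
      ‖emSum (n + a + 1) w - emSum (n + a) w‖ ≤ 1 * (1 / ((n + a : ℕ) : ℝ) ^ 3) := fun n w hw => by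
    have hw1 : ‖w - 1‖ < 2 := by simpa [dist_eq_norm] using hw
    have hr := hre w hw
    refine (norm_emSum_succ_sub_le (by omega) (by linarith)).trans ?_
    have hj : ∀ j : ℝ, 0 ≤ j → ‖w + j‖ ≤ 3 + j := fun j hj => by
      calc ‖w + j‖ = ‖(w - 1) + ((1 + j : ℝ) : ℂ)‖ := by congr 1; push_cast; ring
        _ ≤ ‖w - 1‖ + ‖((1 + j : ℝ) : ℂ)‖ := norm_add_le _ _
        _ ≤ 2 + (1 + j) := by
          gcongr
          rw [Complex.norm_real, Real.norm_of_nonneg (by linarith)]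
        _ = _ := by ring
    have j0 := hj 0 le_rfl
    have j1 := hj 1 (by norm_num)
    have j2 := hj 2 (by norm_num)
    have j3 := hj 3 (by norm_num)
    push_cast at j0 j1 j2 j3
    rw [add_zero] at j0
    -- The product `2 * 3 * 4 * 5 * 6 = 720` cancels the denominator in `norm_emSum_succ_sub_le`.
    have hb : ‖(w - 1) * (w * (w + 1) * (w + 2) * (w + 3))‖ ≤ 2 * (3 * 4 * 5 * 6) := by
      simp only [norm_mul]
      gcongr
      · linarith
      · linarith
      · linarith
      · linarith
    have hp : (1 : ℝ) ≤ ((n + a : ℕ) : ℝ) := by exact_mod_cast (by omega : 1 ≤ n + a)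
    have hq : ((n + a : ℕ) : ℝ) ^ (-w.re - 4) ≤ 1 / ((n + a : ℕ) : ℝ) ^ 3 := by
      calc ((n + a : ℕ) : ℝ) ^ (-w.re - 4) ≤ ((n + a : ℕ) : ℝ) ^ (-3 : ℝ) :=
            Real.rpow_le_rpow_of_exponent_le hp (by linarith)
        _ = _ := by rw [Real.rpow_neg (by linarith)]; norm_cast; simp
    gcongr
    linarith
  have hu : Summable fun n : ℕ => 1 * (1 / ((n + a : ℕ) : ℝ) ^ 3) := by
    have := (summable_nat_add_iff a).mpr (Real.summable_one_div_nat_pow.mpr (by norm_num : 1 < 3))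
    simpa using this
  have hsummable : ∀ w ∈ Metric.ball (1 : ℂ) 2,
      Summable fun n => emSum (n + a + 1) w - emSum (n + a) w := fun w hw =>
    hu.of_norm_bounded fun n => hle n w hw
  have hdiff : DifferentiableOn ℂ
      (fun w => ∑' n : ℕ, (emSum (n + a + 1) w - emSum (n + a) w)) (Metric.ball 1 2) :=
    Complex.differentiableOn_tsum_of_summable_norm hu
      (fun n => ((differentiable_emSum (by omega)).sub
        (differentiable_emSum (by omega))).differentiableOn) Metric.isOpen_ball hle
  have hdiff2 : Differentiable ℂ fun w => (w - 1) * zetaRegularPart w - emSum a w :=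
    ((by fun_prop : Differentiable ℂ fun w : ℂ => w - 1).mul differentiable_zetaRegularPart).sub
      (differentiable_emSum ha)
  have hright : ∀ w ∈ Metric.ball (1 : ℂ) 2, 1 < w.re →
      ∑' n : ℕ, (emSum (n + a + 1) w - emSum (n + a) w) =
        (w - 1) * zetaRegularPart w - emSum a w := fun w hw hw1 => by
    refine tendsto_nhds_unique (hsummable w hw).hasSum.tendsto_sum_nat ?_
    have := ((tendsto_add_atTop_iff_nat a).mpr (tendsto_emSum hw1)).sub_const (emSum a w)
    refine this.congr fun n => ?_
    have h := sum_range_sub (fun n => emSum (n + a) w) n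
    simp only [zero_add] at h
    rw [← h]
    refine sum_congr rfl fun k _ => ?_
    rw [show k + a + 1 = k + 1 + a by ring]
  have heq := AnalyticOnNhd.eqOn_of_preconnected_of_eventuallyEq
    (hdiff.analyticOnNhd Metric.isOpen_ball)
    (hdiff2.differentiableOn.analyticOnNhd Metric.isOpen_ball)
    (convex_ball (1 : ℂ) 2).isPreconnected (z₀ := 2)
    (by simp [dist_eq_norm]; norm_num)
    (by
      filter_upwards [Metric.isOpen_ball.mem_nhds
          (by simp [dist_eq_norm]; norm_num : (2 : ℂ) ∈ Metric.ball (1 : ℂ) 2),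
        (isOpen_lt continuous_const Complex.continuous_re).mem_nhds
          (by simp : (2 : ℂ) ∈ {w : ℂ | 1 < w.re})] with w hw hw1
      exact hright w hw hw1)
  have h := heq hs
  simp only at h
  rw [← h]
  exact (hsummable s hs).hasSum

theorem one_div_pow_four_le {p : ℝ} (hp : 0 < p) :
    1 / (p + 1) ^ 4 ≤ 1 / 3 * (1 / p ^ 3 - 1 / (p + 1) ^ 3) := by
  rw [div_sub_div _ _ (by positivity) (by positivity), ← mul_div_assoc,
    div_le_div_iff₀ (by positivity) (by positivity)]
  nlinarith [pow_pos hp 2, pow_pos hp 3, pow_pos hp 4, pow_pos hp 5, pow_pos hp 6, pow_pos hp 7]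

/-- On the circle the increment at `n` is at most `120 / 720 * n ^ (-4)`, since `Re s ≥ 0`;
comparison with a telescoping difference of inverse cubes sums these bounds. -/
theorem norm_sub_emSum_le {a : ℕ} (ha : 2 ≤ a) {s : ℂ} (hs : ‖s - 1‖ = 1) :
    ‖(s - 1) * zetaRegularPart s - emSum a s‖ ≤ 1 / (18 * ((a : ℝ) - 1) ^ 3) := by
  have ha' : (2 : ℝ) ≤ a := by exact_mod_cast ha
  have hre : 0 ≤ s.re := by
    have h1 : |(s - 1).re| ≤ 1 := (Complex.abs_re_le_norm _).trans hs.le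
    have := (abs_le.mp h1).1
    simp at this; linarith
  have hj : ∀ j : ℝ, 0 ≤ j → ‖s + j‖ ≤ 2 + j := fun j hj => by
    calc ‖s + j‖ = ‖(s - 1) + ((1 + j : ℝ) : ℂ)‖ := by congr 1; push_cast; ring
      _ ≤ ‖s - 1‖ + ‖((1 + j : ℝ) : ℂ)‖ := norm_add_le _ _
      _ = 1 + (1 + j) := by rw [hs, Complex.norm_real, Real.norm_of_nonneg (by linarith)]
      _ = _ := by ring
  have j0 := hj 0 le_rfl
  have j1 := hj 1 (by norm_num)
  have j2 := hj 2 (by norm_num)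
  have j3 := hj 3 (by norm_num)
  push_cast at j0 j1 j2 j3
  rw [add_zero] at j0
  have hb : ‖(s - 1) * (s * (s + 1) * (s + 2) * (s + 3))‖ ≤ 1 * (2 * 3 * 4 * 5) := by
    simp only [norm_mul]
    gcongr
    · linarith
    · linarith
    · linarith
    · linarith
    · linarith
  set v : ℕ → ℝ := fun n => 1 / 18 * (1 / ((n : ℝ) + (a - 1)) ^ 3) with hv
  have hterm : ∀ n : ℕ, ‖emSum (n + a + 1) s - emSum (n + a) s‖ ≤ v n - v (n + 1) := fun n => by
    have hp : (1 : ℝ) ≤ ((n + a : ℕ) : ℝ) := by exact_mod_cast (by omega : 1 ≤ n + a)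
    have hn0 : (0 : ℝ) ≤ n := n.cast_nonneg
    calc _ ≤ ‖(s - 1) * (s * (s + 1) * (s + 2) * (s + 3))‖ / 720 *
          ((n + a : ℕ) : ℝ) ^ (-s.re - 4) := norm_emSum_succ_sub_le (by omega) (by linarith)
      _ ≤ 1 * (2 * 3 * 4 * 5) / 720 * ((n + a : ℕ) : ℝ) ^ (-4 : ℝ) := by
          gcongr
          linarith
      _ = 1 / 6 * (1 / (((n : ℝ) + (a - 1)) + 1) ^ 4) := by
          rw [Real.rpow_neg (by linarith), show (4 : ℝ) = (4 : ℕ) by norm_num, Real.rpow_natCast,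
            show (n : ℝ) + (a - 1) + 1 = ((n + a : ℕ) : ℝ) by push_cast; ring]
          norm_num
      _ ≤ 1 / 6 * (1 / 3 * (1 / ((n : ℝ) + (a - 1)) ^ 3 - 1 / ((n : ℝ) + (a - 1) + 1) ^ 3)) := by
          gcongr
          exact one_div_pow_four_le (by linarith)
      _ = _ := by
          simp only [hv]
          push_cast
          rw [show (n : ℝ) + 1 + (a - 1) = n + (a - 1) + 1 by ring]
          ring
  have hv0 : Tendsto v atTop (𝓝 0) := by
    have h1 : Tendsto (fun n : ℕ => (n : ℝ) + (a - 1)) atTop atTop :=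
      tendsto_atTop_add_const_right _ _ tendsto_natCast_atTop_atTop
    have h2 := ((tendsto_pow_atTop (by norm_num : 3 ≠ 0)).comp h1).inv_tendsto_atTop.const_mul
      (1 / 18 : ℝ)
    simpa [hv, Function.comp_def] using h2
  have hsum : HasSum (fun n => v n - v (n + 1)) (v 0) := by
    rw [hasSum_iff_tendsto_nat_of_nonneg fun n => (norm_nonneg _).trans (hterm n)]
    simp only [sum_range_sub']
    simpa using hv0.const_sub (v 0)
  have := (hasSum_emSum_succ_sub (a := a) (by omega) (s := s)
    (by simp [dist_eq_norm, hs])).norm_le_of_bounded hsum hterm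
  refine this.trans (le_of_eq ?_)
  simp [hv]
  ring

/-! ### Derivatives at `s = 1` -/

/-- By Leibniz. At `s = 1` only `(m + 1)` times the `m`-th derivative of `h` survives, which undoes
the factor `s - 1`. -/
theorem iteratedDeriv_sub_one_mul {h : ℂ → ℂ} (hh : Differentiable ℂ h) (m : ℕ) :
    iteratedDeriv (m + 1) (fun s => (s - 1) * h s) =
      fun s => (s - 1) * iteratedDeriv (m + 1) h s + (m + 1) * iteratedDeriv m h s := by
  have hd : ∀ n s, HasDerivAt (iteratedDeriv n h) (iteratedDeriv (n + 1) h s) s := fun n s => by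
    rw [iteratedDeriv_succ]
    exact ((hh.contDiff (n := (n + 1 : ℕ))).differentiable_iteratedDeriv n
      (by exact_mod_cast n.lt_succ_self)).differentiableAt.hasDerivAt
  have hs : ∀ s : ℂ, HasDerivAt (fun s : ℂ => s - 1) 1 s := fun s => (hasDerivAt_id s).sub_const _
  induction m with
  | zero =>
    ext s
    rw [iteratedDeriv_succ, iteratedDeriv_zero]
    have h0 := hd 0 s
    rw [iteratedDeriv_zero] at h0
    rw [((hs s).fun_mul h0).deriv]
    simp
    ring
  | succ m ih =>
    ext s
    rw [iteratedDeriv_succ, ih]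
    rw [(((hs s).fun_mul (hd (m + 1) s)).fun_add ((hd m s).const_mul _)).deriv]
    push_cast
    ring

theorem iteratedDeriv_natCast_cpow_const_sub {k : ℕ} (hk : 0 < k) (b : ℂ) (m : ℕ) :
    iteratedDeriv m (fun s : ℂ => (k : ℂ) ^ (b - s)) =
      fun s => (((-Real.log k) ^ m : ℝ) : ℂ) * (k : ℂ) ^ (b - s) := by
  have hk' : (k : ℂ) ≠ 0 := by exact_mod_cast hk.ne'
  induction m with
  | zero => simp
  | succ m ih =>
    ext s
    rw [iteratedDeriv_succ, ih]
    have h1 : HasDerivAt (fun s : ℂ => b - s) (-1) s := (hasDerivAt_id s).const_sub b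
    rw [((h1.const_cpow (c := (k : ℂ)) (Or.inl hk')).const_mul _).deriv, ← Complex.natCast_log]
    push_cast
    ring

/-- The `m`-th derivative at `1` of the Euler–Maclaurin approximation of the regular part of `ζ`. -/
noncomputable def emStieltjes (m a : ℕ) : ℝ :=
  ∑ k ∈ range a, (-Real.log ((k + 1 : ℕ) : ℝ)) ^ m / ((k + 1 : ℕ) : ℝ) - (-Real.log a) ^ m / (2 * a)
    + (m * (-Real.log a) ^ (m - 1) + (-Real.log a) ^ m) / (12 * a ^ 2)
    + (-Real.log a) ^ (m + 1) / (m + 1)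

theorem iteratedDeriv_emSum {a : ℕ} (ha : 0 < a) (m : ℕ) :
    iteratedDeriv (m + 1) (emSum a) 1 = ((m + 1 : ℝ) * emStieltjes m a : ℝ) := by
  have ha' : (a : ℂ) ≠ 0 := by exact_mod_cast ha.ne'
  have hc : ∀ k : ℕ, 0 < k → ∀ b : ℂ, Differentiable ℂ fun s => (k : ℂ) ^ (b - s) :=
    fun k hk b => (by fun_prop : Differentiable ℂ fun s : ℂ => b - s).const_cpow
      (Or.inl (by exact_mod_cast hk.ne'))
  have hsum : Differentiable ℂ fun s : ℂ => ∑ k ∈ range a, ((k + 1 : ℕ) : ℂ) ^ (0 - s) :=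
    Differentiable.fun_sum fun k _ => hc (k + 1) k.succ_pos 0
  have hlin : Differentiable ℂ fun s : ℂ => (s - 1) * (a : ℂ) ^ (-1 - s) :=
    (by fun_prop : Differentiable ℂ fun s : ℂ => s - 1).mul (hc a ha _)
  -- The correction coefficient `s / 12` is split as `(s - 1) / 12 + 1 / 12`, so that the product
  -- rule above applies to each piece.
  set h : ℂ → ℂ := fun s => (∑ k ∈ range a, ((k + 1 : ℕ) : ℂ) ^ (0 - s)
    + (-1 / 2 : ℂ) * (a : ℂ) ^ (0 - s)) + ((1 / 12 : ℂ) * ((s - 1) * (a : ℂ) ^ (-1 - s))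
      + (1 / 12 : ℂ) * (a : ℂ) ^ (-1 - s)) with hh
  have hdA := hsum.fun_add ((hc a ha 0).const_mul (-1 / 2 : ℂ))
  have hdB := (hlin.const_mul (1 / 12 : ℂ)).fun_add ((hc a ha (-1)).const_mul (1 / 12 : ℂ))
  have hhd : Differentiable ℂ h := hdA.fun_add hdB
  have e : emSum a = fun s => ((s - 1) * h s + (a : ℂ) ^ (1 - s)) - 1 := by
    ext s
    simp only [emSum, hh, zero_sub, show -s - 1 = -1 - s by ring]
    ring
  have hsm : Differentiable ℂ fun s => (s - 1) * h s :=
    (by fun_prop : Differentiable ℂ fun s : ℂ => s - 1).mul hhd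
  have cd : ∀ {g : ℂ → ℂ} {n : ℕ}, Differentiable ℂ g → ContDiffAt ℂ n g 1 :=
    fun hg => hg.contDiff.contDiffAt
  have e1 : iteratedDeriv (m + 1) (emSum a) 1 =
      (m + 1) * iteratedDeriv m h 1 + ((-Real.log a) ^ (m + 1) : ℝ) := by
    have hone : iteratedDeriv (m + 1) (fun _ : ℂ => (1 : ℂ)) 1 = 0 := by
      simp [iteratedDeriv_const]
    rw [e, iteratedDeriv_fun_sub (cd (hsm.fun_add (hc a ha 1))) (cd (differentiable_const _)), hone,
      iteratedDeriv_fun_add (cd hsm) (cd (hc a ha 1)), iteratedDeriv_sub_one_mul hhd,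
      iteratedDeriv_natCast_cpow_const_sub ha]
    simp
  have e2 : iteratedDeriv m (fun s : ℂ => (s - 1) * (a : ℂ) ^ (-1 - s)) 1 =
      ((m * (-Real.log a) ^ (m - 1) / a ^ 2 : ℝ) : ℂ) := by
    -- For `m = 0` the truncated exponent `m - 1` is harmless because of the factor `m`.
    cases m with
    | zero => simp
    | succ m =>
      rw [iteratedDeriv_sub_one_mul (hc a ha _), iteratedDeriv_natCast_cpow_const_sub ha (-1) m]
      norm_num [Complex.cpow_neg]
      ring
  have e3 : iteratedDeriv m h 1 = ((∑ k ∈ range a, (-Real.log ((k + 1 : ℕ) : ℝ)) ^ m /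
      ((k + 1 : ℕ) : ℝ) - (-Real.log a) ^ m / (2 * a)
      + (m * (-Real.log a) ^ (m - 1) + (-Real.log a) ^ m) / (12 * a ^ 2) : ℝ) : ℂ) := by
    rw [hh, iteratedDeriv_fun_add (cd hdA) (cd hdB),
      iteratedDeriv_fun_add (cd hsum) (cd ((hc a ha 0).const_mul _)),
      iteratedDeriv_fun_add (cd (hlin.const_mul _)) (cd ((hc a ha (-1)).const_mul _)),
      iteratedDeriv_fun_sum fun k _ => cd (hc (k + 1) k.succ_pos 0),
      iteratedDeriv_const_mul_field, iteratedDeriv_const_mul_field, iteratedDeriv_const_mul_field,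
      e2, iteratedDeriv_natCast_cpow_const_sub ha, iteratedDeriv_natCast_cpow_const_sub ha,
      sum_congr rfl fun k _ => congrFun
        (iteratedDeriv_natCast_cpow_const_sub (Nat.succ_pos k) 0 m) 1]
    have h2 : (a : ℂ) ^ (-1 - 1 : ℂ) = 1 / a ^ 2 := by
      rw [show (-1 - 1 : ℂ) = -(2 : ℕ) by norm_num, Complex.cpow_neg, Complex.cpow_natCast]
      simp
    have h1 : ∀ k : ℕ, (k : ℂ) ^ (0 - 1 : ℂ) = 1 / k := fun k => by
      rw [zero_sub, Complex.cpow_neg_one]; simp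
    simp only [h2, h1]
    push_cast
    simp only [mul_one_div]
    field_simp
    ring
  rw [e1, e3, emStieltjes]
  have : (m : ℂ) + 1 ≠ 0 := by exact_mod_cast m.succ_ne_zero
  push_cast
  field_simp

/-- Cauchy's estimate on the unit circle gives `(m + 1)!` for the derivative of order `m + 1`;
dividing by `m + 1` leaves `m!`. -/
theorem norm_iteratedDeriv_zetaRegularPart_sub_le (m : ℕ) {a : ℕ} (ha : 2 ≤ a) :
    ‖iteratedDeriv m zetaRegularPart 1 - (emStieltjes m a : ℂ)‖ ≤
      m.factorial / (18 * ((a : ℝ) - 1) ^ 3) := by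
  have hd1 : Differentiable ℂ fun s => (s - 1) * zetaRegularPart s :=
    (by fun_prop : Differentiable ℂ fun s : ℂ => s - 1).mul differentiable_zetaRegularPart
  have hd2 := differentiable_emSum (n := a) (by omega)
  have h := Complex.norm_iteratedDeriv_le_of_forall_mem_sphere_norm_le (m + 1) one_pos
    (hd1.sub hd2).diffContOnCl (c := (1 : ℂ)) (C := 1 / (18 * ((a : ℝ) - 1) ^ 3))
    fun z hz => norm_sub_emSum_le ha (by simpa [dist_eq_norm] using hz)
  rw [iteratedDeriv_sub hd1.contDiff.contDiffAt hd2.contDiff.contDiffAt,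
    iteratedDeriv_sub_one_mul differentiable_zetaRegularPart, iteratedDeriv_emSum (by omega)] at h
  have hm : (0 : ℝ) < m + 1 := by positivity
  have e : (1 - 1 : ℂ) * iteratedDeriv (m + 1) zetaRegularPart 1
      + (m + 1) * iteratedDeriv m zetaRegularPart 1 - (((m + 1 : ℝ) * emStieltjes m a : ℝ) : ℂ)
      = ((m + 1 : ℝ) : ℂ) * (iteratedDeriv m zetaRegularPart 1 - (emStieltjes m a : ℂ)) := by
    push_cast; ring
  rw [e, norm_mul, Complex.norm_real, Real.norm_of_nonneg hm.le, Nat.factorial_succ] at h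
  push_cast at h
  refine le_of_mul_le_mul_left (h.trans (le_of_eq ?_)) hm
  rw [one_pow, div_one, mul_one_div, mul_div_assoc]

/-- The derivative is real as a limit of real approximations: its imaginary part is below every
error bound. -/
theorem exists_real_iteratedDeriv_zetaRegularPart (m : ℕ) :
    ∃ x : ℝ, iteratedDeriv m zetaRegularPart 1 = (x : ℂ) ∧
      ∀ a : ℕ, 2 ≤ a → |x - emStieltjes m a| ≤ m.factorial / (18 * ((a : ℝ) - 1) ^ 3) := by
  set z := iteratedDeriv m zetaRegularPart 1 with hz
  have hb := fun a (ha : 2 ≤ a) => norm_iteratedDeriv_zetaRegularPart_sub_le m ha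
  have him : z.im = 0 := by
    have h1 : Tendsto (fun a : ℕ => (a : ℝ) - 1) atTop atTop :=
      tendsto_atTop_add_const_right _ _ tendsto_natCast_atTop_atTop
    have h2 := ((tendsto_pow_atTop (by norm_num : 3 ≠ 0)).comp h1).inv_tendsto_atTop.const_mul
      (m.factorial / 18 : ℝ)
    rw [mul_zero] at h2
    have h3 : |z.im| ≤ 0 := by
      refine ge_of_tendsto h2 ?_
      filter_upwards [eventually_ge_atTop 2] with a ha
      have h4 := (Complex.abs_im_le_norm _).trans (hb a ha)
      simp only [Complex.sub_im, Complex.ofReal_im, sub_zero] at h4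
      refine h4.trans (le_of_eq ?_)
      simp only [Pi.inv_apply, Function.comp_apply]
      rw [div_mul_eq_div_div, div_eq_mul_inv _ (((a : ℝ) - 1) ^ 3)]
    exact abs_nonpos_iff.mp h3
  refine ⟨z.re, Complex.ext (by simp) (by simp [him]), fun a ha => ?_⟩
  have h4 := (Complex.abs_re_le_norm _).trans (hb a ha)
  simpa using h4

/-! ### Numerical values of the approximations at `a = 8` -/

theorem log_seven_bounds : 1.9459101 ≤ Real.log 7 ∧ Real.log 7 ≤ 1.9459102 := by
  have h1 := Real.sum_range_le_log_div (x := 1 / 99) (by norm_num) (by norm_num) 2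
  have h2 := Real.log_div_le_sum_range_add (x := 1 / 99) (by norm_num) (by norm_num) 2
  -- The argument is `50 / 49 = 2 * 5 ^ 2 / 7 ^ 2`, so close to 1 that two terms of the series
  -- suffice.
  have e : Real.log ((1 + 1 / 99) / (1 - 1 / 99)) = Real.log 2 + 2 * Real.log 5 - 2 * Real.log 7 := by
    have h : (2 : ℝ) * Real.log 5 = Real.log (5 ^ 2) := by rw [Real.log_pow]; norm_num
    have h' : (2 : ℝ) * Real.log 7 = Real.log (7 ^ 2) := by rw [Real.log_pow]; norm_num
    rw [h, h', ← Real.log_mul (by norm_num) (by norm_num),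
      ← Real.log_div (by norm_num) (by norm_num)]
    norm_num
  rw [e] at h1 h2
  norm_num [sum_range_succ] at h1 h2
  have := Real.log_two_gt_d9
  have := Real.log_two_lt_d9
  have := Real.log_five_gt_d9
  have := Real.log_five_lt_d9
  constructor <;> linarith

theorem log_six_eq : Real.log 6 = Real.log 2 + Real.log 3 := by
  rw [← Real.log_mul (by norm_num) (by norm_num)]; norm_num

theorem log_eight_eq : Real.log 8 = 3 * Real.log 2 := by
  rw [show (8 : ℝ) = 2 ^ 3 by norm_num, Real.log_pow]; norm_num

theorem pow_bounds {l x u : ℝ} (hl : 0 ≤ l) (h : l ≤ x ∧ x ≤ u) (n : ℕ) :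
    l ^ n ≤ x ^ n ∧ x ^ n ≤ u ^ n :=
  ⟨pow_le_pow_left₀ hl h.1 n, pow_le_pow_left₀ (hl.trans h.1) h.2 n⟩

theorem log_two_bounds : 0.6931471 ≤ Real.log 2 ∧ Real.log 2 ≤ 0.6931472 := by
  constructor <;> linarith [Real.log_two_gt_d9, Real.log_two_lt_d9]

theorem log_three_bounds : 1.0986122 ≤ Real.log 3 ∧ Real.log 3 ≤ 1.0986123 := by
  constructor <;> linarith [Real.log_three_gt_d9, Real.log_three_lt_d9]

theorem log_five_bounds : 1.6094379 ≤ Real.log 5 ∧ Real.log 5 ≤ 1.6094380 := by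
  constructor <;> linarith [Real.log_five_gt_d9, Real.log_five_lt_d9]

theorem log_six_bounds : 1.7917593 ≤ Real.log 6 ∧ Real.log 6 ≤ 1.7917595 := by
  rw [log_six_eq]
  constructor <;> linarith [log_two_bounds.1, log_two_bounds.2, log_three_bounds.1,
    log_three_bounds.2]

theorem emStieltjes_zero_bounds : 0.5771 ≤ emStieltjes 0 8 ∧ emStieltjes 0 8 ≤ 0.5773 := by
  obtain ⟨_, _⟩ := log_two_bounds
  norm_num [emStieltjes, sum_range_succ, log_eight_eq]
  constructor <;> linarith

theorem emStieltjes_one_bounds : 0.0727 ≤ emStieltjes 1 8 ∧ emStieltjes 1 8 ≤ 0.0729 := by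
  obtain ⟨_, _⟩ := log_two_bounds
  obtain ⟨_, _⟩ := log_three_bounds
  obtain ⟨_, _⟩ := log_five_bounds
  obtain ⟨_, _⟩ := log_seven_bounds
  obtain ⟨_, _⟩ := pow_bounds (by norm_num) log_two_bounds 2
  norm_num [emStieltjes, sum_range_succ, Real.log_four_eq, log_six_eq, log_eight_eq] at *
  constructor <;> linarith

theorem emStieltjes_two_bounds : -0.0098 ≤ emStieltjes 2 8 ∧ emStieltjes 2 8 ≤ -0.0096 := by
  obtain ⟨_, _⟩ := log_two_bounds
  obtain ⟨_, _⟩ := pow_bounds (by norm_num) log_two_bounds 2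
  obtain ⟨_, _⟩ := pow_bounds (by norm_num) log_three_bounds 2
  obtain ⟨_, _⟩ := pow_bounds (by norm_num) log_five_bounds 2
  obtain ⟨_, _⟩ := pow_bounds (by norm_num) log_six_bounds 2
  obtain ⟨_, _⟩ := pow_bounds (by norm_num) log_seven_bounds 2
  obtain ⟨_, _⟩ := pow_bounds (by norm_num) log_two_bounds 3
  norm_num [emStieltjes, sum_range_succ, Real.log_four_eq, log_eight_eq] at *
  constructor <;> linarith

theorem emStieltjes_three_bounds : -0.0021 ≤ emStieltjes 3 8 ∧ emStieltjes 3 8 ≤ -0.0020 := by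
  obtain ⟨_, _⟩ := pow_bounds (by norm_num) log_two_bounds 2
  obtain ⟨_, _⟩ := pow_bounds (by norm_num) log_two_bounds 3
  obtain ⟨_, _⟩ := pow_bounds (by norm_num) log_three_bounds 3
  obtain ⟨_, _⟩ := pow_bounds (by norm_num) log_five_bounds 3
  obtain ⟨_, _⟩ := pow_bounds (by norm_num) log_six_bounds 3
  obtain ⟨_, _⟩ := pow_bounds (by norm_num) log_seven_bounds 3
  obtain ⟨_, _⟩ := pow_bounds (by norm_num) log_two_bounds 4
  norm_num [emStieltjes, sum_range_succ, Real.log_four_eq, log_eight_eq] at *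
  constructor <;> linarith

/-! ### Size and growth of the Bernoulli numbers -/

theorem bernoulli_six : bernoulli 6 = 1 / 42 := by
  rw [bernoulli_eq_bernoulli'_of_ne_one (by norm_num), bernoulli'_def]
  have h5 : bernoulli' 5 = 0 := bernoulli'_eq_zero_of_odd (by decide) (by norm_num)
  norm_num [sum_range_succ, h5, Nat.choose]

theorem bernoulli_eight : bernoulli 8 = -1 / 30 := by
  rw [bernoulli_eq_bernoulli'_of_ne_one (by norm_num), bernoulli'_def]
  have h5 : bernoulli' 5 = 0 := bernoulli'_eq_zero_of_odd (by decide) (by norm_num)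
  have h7 : bernoulli' 7 = 0 := bernoulli'_eq_zero_of_odd (by decide) (by norm_num)
  have h6 : bernoulli' 6 = 1 / 42 := by
    rw [← bernoulli_eq_bernoulli'_of_ne_one (by norm_num), bernoulli_six]
  norm_num [sum_range_succ, h5, h6, h7, Nat.choose]

theorem bernoulli_four : bernoulli 4 = -1 / 30 := by
  rw [bernoulli_eq_bernoulli'_of_ne_one (by norm_num), bernoulli'_four]

/-- `|B_{2k}| / (2k)`, with the sign `(-1) ^ (k + 1)` of `B_{2k}` made explicit. -/
noncomputable def bernoulliRatio (k : ℕ) : ℝ := (-1) ^ (k + 1) * (bernoulli (2 * k) : ℝ) / (2 * k)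

theorem neg_one_pow_mul_bernoulliRatio (k : ℕ) :
    (-1) ^ (k + 1) * bernoulliRatio k = (bernoulli (2 * k) : ℝ) / (2 * k) := by
  have : ((-1 : ℝ) ^ (k + 1)) * (-1) ^ (k + 1) = 1 := by rw [← mul_pow]; simp
  rw [bernoulliRatio, mul_div_assoc, ← mul_assoc, this, one_mul]

theorem hasSum_bernoulliRatio {k : ℕ} (hk : 0 < k) :
    HasSum (fun n : ℕ => 1 / (n : ℝ) ^ (2 * k))
      (bernoulliRatio k * ((2 * Real.pi) ^ (2 * k) / (2 * (2 * k - 1).factorial))) := by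
  convert! hasSum_zeta_nat hk.ne' using 1
  have h1 : (2 * k).factorial = 2 * k * (2 * k - 1).factorial :=
    (Nat.mul_factorial_pred (by omega)).symm
  have h2 : (2 : ℝ) ^ (2 * k) = 2 ^ (2 * k - 1) * 2 := by rw [← pow_succ]; congr 1; omega
  have h3 : (k : ℝ) ≠ 0 := by exact_mod_cast hk.ne'
  have h4 : ((2 * k - 1).factorial : ℝ) ≠ 0 := by exact_mod_cast Nat.factorial_ne_zero _
  rw [bernoulliRatio, h1, mul_pow, h2]
  push_cast
  field_simp

theorem one_le_tsum_zeta {k : ℕ} (hk : 0 < k) :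
    1 ≤ bernoulliRatio k * ((2 * Real.pi) ^ (2 * k) / (2 * (2 * k - 1).factorial)) := by
  have := le_hasSum (hasSum_bernoulliRatio hk) 1 fun j _ => by positivity
  simpa using this

theorem tsum_zeta_le {k : ℕ} (hk : 0 < k) :
    bernoulliRatio k * ((2 * Real.pi) ^ (2 * k) / (2 * (2 * k - 1).factorial)) ≤
      Real.pi ^ 2 / 6 := by
  refine hasSum_le (fun n => ?_) (hasSum_bernoulliRatio hk) hasSum_zeta_two
  rcases Nat.eq_zero_or_pos n with rfl | hn
  · simp [hk.ne']
  · have : (1 : ℝ) ≤ n := by exact_mod_cast hn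
    gcongr
    omega

theorem bernoulliRatio_pos {k : ℕ} (hk : 0 < k) : 0 < bernoulliRatio k := by
  have h1 := one_le_tsum_zeta hk
  have h2 : 0 < (2 * Real.pi) ^ (2 * k) / (2 * (2 * k - 1).factorial) := by positivity
  exact pos_of_mul_pos_left (by linarith) h2.le

/-- By Euler's formula the ratio of consecutive terms is `(2k + 1)(2k) / (4π²)` times `ζ(2k + 2) /
ζ(2k)`, and the zeta quotient is at least `6 / π²`. This is enough for `k ≥ 4`, where `(2k + 1)(2k)
≥ 72 > 4π⁴ / 6`; for `k = 3` the values `1/252` and `1/240` are compared directly. -/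
theorem bernoulliRatio_le_succ {k : ℕ} (hk : 3 ≤ k) : bernoulliRatio k ≤ bernoulliRatio (k + 1) := by
  rcases hk.eq_or_lt with rfl | hk
  · norm_num [bernoulliRatio, bernoulli_six, bernoulli_eight]
  have h1 := tsum_zeta_le (k := k) (by omega)
  have h2 := one_le_tsum_zeta (k := k + 1) (by omega)
  have hf : (2 * (k + 1) - 1).factorial = (2 * k + 1) * (2 * k) * (2 * k - 1).factorial := by
    rw [show 2 * (k + 1) - 1 = 2 * k + 1 by omega, Nat.factorial_succ, mul_assoc,
      Nat.mul_factorial_pred (by omega)]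
  set F : ℝ := (2 * Real.pi) ^ (2 * k) / (2 * (2 * k - 1).factorial) with hF
  have hFpos : 0 < F := by positivity
  have hk0 : (0 : ℝ) < k := by exact_mod_cast (by omega : 0 < k)
  have hk4 : (4 : ℝ) ≤ k := by exact_mod_cast hk
  have e : (2 * Real.pi) ^ (2 * (k + 1)) / (2 * (2 * (k + 1) - 1).factorial) =
      F * (4 * Real.pi ^ 2) / ((2 * k + 1) * (2 * k)) := by
    have h4 : ((2 * k - 1).factorial : ℝ) ≠ 0 := by exact_mod_cast Nat.factorial_ne_zero _
    rw [hf, hF, show 2 * (k + 1) = 2 * k + 2 by ring, pow_add]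
    push_cast
    field_simp
    ring
  rw [e, ← mul_div_assoc, le_div_iff₀ (by positivity)] at h2
  have hpi : Real.pi ^ 2 < 10 := by
    have := Real.pi_lt_d2; have := Real.pi_pos; nlinarith
  have hpi0 : 0 < Real.pi ^ 2 := by positivity
  have h3 : (72 : ℝ) ≤ (2 * k + 1) * (2 * k) := by nlinarith
  have h5 : bernoulliRatio k * F * (4 * Real.pi ^ 2) ≤
      bernoulliRatio (k + 1) * F * (4 * Real.pi ^ 2) := by
    calc _ ≤ Real.pi ^ 2 / 6 * (4 * Real.pi ^ 2) := by gcongr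
      _ ≤ 72 := by nlinarith
      _ ≤ _ := by linarith
  exact le_of_mul_le_mul_right (le_of_mul_le_mul_right h5 (by positivity)) hFpos

/-! ### Enveloping by an alternating series with growing terms -/

/-- Two further terms change an even partial sum by `c_{2n+3} - c_{2n+4} ≤ 0` and an odd one by
`c_{2n+5} - c_{2n+4} ≥ 0`, so the bracket only widens. -/
theorem alternating_sum_bounds {c : ℕ → ℝ} (h0 : ∀ k, 3 ≤ k → c k ≤ c (k + 1)) {x : ℝ}
    (h2 : ∑ k ∈ Icc 1 2, (-1) ^ (k + 1) * c k < x)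
    (h3 : x < ∑ k ∈ Icc 1 3, (-1) ^ (k + 1) * c k) (n : ℕ) :
    ∑ k ∈ Icc 1 (2 * n + 2), (-1) ^ (k + 1) * c k < x ∧
      x < ∑ k ∈ Icc 1 (2 * n + 3), (-1) ^ (k + 1) * c k := by
  induction n with
  | zero => exact ⟨h2, h3⟩
  | succ n ih =>
    have e : ∀ m, ∑ k ∈ Icc 1 (m + 1), (-1) ^ (k + 1) * c k =
        ∑ k ∈ Icc 1 m, (-1) ^ (k + 1) * c k + (-1) ^ m * c (m + 1) := fun m => by
      rw [sum_Icc_succ_top (by omega)]; ring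
    have h4 := e (2 * n + 2)
    have h5 := e (2 * n + 3)
    have h6 := e (2 * n + 4)
    have p : (-1 : ℝ) ^ (2 * n) = 1 := by simp
    simp only [pow_add, p] at h4 h5 h6
    have m1 := h0 (2 * n + 3) (by omega)
    have m2 := h0 (2 * n + 4) (by omega)
    rw [show 2 * (n + 1) + 2 = 2 * n + 3 + 1 by ring, show 2 * (n + 1) + 3 = 2 * n + 4 + 1 by ring]
    simp only [pow_add] at ih ⊢
    norm_num [add_assoc] at *
    constructor <;> linarith

/-- Since `x` lies strictly between `S N` and `S (N + 1)`, `θ` is the fraction of the step at which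
`x` is reached. The alternative `0 < x` serves `N = 0`, where the lower sum is empty. -/
theorem exists_theta_of_alternating {c : ℕ → ℝ} (h0 : ∀ k, 3 ≤ k → c k ≤ c (k + 1)) {x : ℝ}
    (h2 : ∑ k ∈ Icc 1 2, (-1) ^ (k + 1) * c k < x)
    (h3 : x < ∑ k ∈ Icc 1 3, (-1) ^ (k + 1) * c k) (h1 : x < c 1) {N : ℕ} (hN : 1 ≤ N ∨ 0 < x) :
    ∃ θ : ℝ, 0 < θ ∧ θ < 1 ∧ x = ∑ k ∈ Icc 1 N, (-1) ^ (k + 1) * c k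
      + θ * ((-1) ^ N * c (N + 1)) := by
  set S : ℕ → ℝ := fun N => ∑ k ∈ Icc 1 N, (-1) ^ (k + 1) * c k with hS
  have e : ∀ m, S (m + 1) = S m + (-1) ^ m * c (m + 1) := fun m => by
    simp only [hS]; rw [sum_Icc_succ_top (by omega)]; ring
  have key : (S N < x ∧ x < S (N + 1)) ∨ (S (N + 1) < x ∧ x < S N) := by
    have hb := alternating_sum_bounds h0 h2 h3
    rcases Nat.even_or_odd' N with ⟨n, rfl | rfl⟩
    · left
      rcases n with _ | n
      · simpa [hS] using ⟨by simpa using hN, h1⟩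
      · exact hb n
    · right
      rcases n with _ | n
      · exact ⟨h2, by simpa [hS] using h1⟩
      · exact ⟨(hb (n + 1)).1, (hb n).2⟩
  have hne : (-1) ^ N * c (N + 1) = S (N + 1) - S N := by rw [e]; ring
  rw [hne]
  rcases key with ⟨a, b⟩ | ⟨a, b⟩
  · refine ⟨(x - S N) / (S (N + 1) - S N), div_pos (by linarith) (by linarith),
      (div_lt_one (by linarith)).mpr (by linarith), ?_⟩
    rw [div_mul_cancel₀ _ (by linarith)]
    ring
  · refine ⟨(S N - x) / (S N - S (N + 1)), div_pos (by linarith) (by linarith),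
      (div_lt_one (by linarith)).mpr (by linarith), ?_⟩
    have : S (N + 1) - S N = -(S N - S (N + 1)) := by ring
    rw [this, mul_neg, div_mul_cancel₀ _ (by linarith)]
    ring

/-- The constants 12, 120 and 252 are `2k / |B_{2k}|` for `k = 1, 2, 3`: the hypotheses on `x`
compare it with the first three partial sums. -/
theorem exists_theta_of_bernoulli {Q : ℕ → ℝ} (hQ0 : ∀ n, 0 ≤ Q n) (hQ : Monotone Q) {x : ℝ}
    (h1 : x < Q 1 / 12) (h2 : Q 1 / 12 - Q 3 / 120 < x)
    (h3 : x < Q 1 / 12 - Q 3 / 120 + Q 5 / 252) {N : ℕ} (hN : 1 ≤ N ∨ 0 < x) :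
    ∃ θ : ℝ, 0 < θ ∧ θ < 1 ∧
      x = 1 / 2 * ∑ k ∈ Icc 1 N, (bernoulli (2 * k) : ℝ) * Q (2 * k - 1) / k
        + θ * ((bernoulli (2 * N + 2) : ℝ) * Q (2 * N + 1) / (2 * N + 2)) := by
  have b1 : bernoulliRatio 1 = 1 / 12 := by norm_num [bernoulliRatio, bernoulli_two]
  have b2 : bernoulliRatio 2 = 1 / 120 := by norm_num [bernoulliRatio, bernoulli_four]
  have b3 : bernoulliRatio 3 = 1 / 252 := by norm_num [bernoulliRatio, bernoulli_six]
  have hc : ∀ k, (-1) ^ (k + 1) * (bernoulliRatio k * Q (2 * k - 1)) =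
      1 / 2 * ((bernoulli (2 * k) : ℝ) * Q (2 * k - 1) / k) := fun k => by
    rw [← mul_assoc, neg_one_pow_mul_bernoulliRatio, mul_comm (2 : ℝ), ← div_div]
    ring
  obtain ⟨θ, hθ0, hθ1, h⟩ := exists_theta_of_alternating
    (c := fun k => bernoulliRatio k * Q (2 * k - 1)) (x := x) (N := N)
    (fun k hk => mul_le_mul (bernoulliRatio_le_succ hk) (hQ (by omega)) (hQ0 _)
      (bernoulliRatio_pos (by omega)).le)
    (by norm_num [sum_Icc_succ_top, b1, b2]; linarith)
    (by norm_num [sum_Icc_succ_top, b1, b2, b3]; linarith)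
    (by norm_num [b1]; linarith) hN
  refine ⟨θ, hθ0, hθ1, h.trans ?_⟩
  have hl : (-1) ^ N * (bernoulliRatio (N + 1) * Q (2 * (N + 1) - 1)) =
      (bernoulli (2 * N + 2) : ℝ) * Q (2 * N + 1) / (2 * N + 2) := by
    have h := neg_one_pow_mul_bernoulliRatio (N + 1)
    rw [show (-1 : ℝ) ^ (N + 1 + 1) = (-1) ^ N by ring] at h
    rw [← mul_assoc, h, show 2 * (N + 1) - 1 = 2 * N + 1 by omega,
      show 2 * (N + 1) = 2 * N + 2 by ring]
    push_cast
    rw [show (2 : ℝ) * (N + 1) = 2 * N + 2 by ring]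
    ring
  simp only [hl, sum_congr rfl fun k _ => hc k, mul_sum]

/-! ### Monotonicity of the harmonic weights -/

theorem genHarmonic_succ (r n : ℕ) :
    genHarmonic r (n + 1) = genHarmonic r n + 1 / ((n : ℚ) + 1) ^ r := by
  rw [genHarmonic, sum_Icc_succ_top (by omega)]
  simp [genHarmonic]

theorem harmonic_nonneg (n : ℕ) : 0 ≤ harmonic n := sum_nonneg fun _ _ => by positivity

theorem monotone_harmonic : Monotone harmonic :=
  monotone_nat_of_le_succ fun n => by
    rw [harmonic_succ]
    have : (0 : ℚ) ≤ ((n + 1 : ℕ) : ℚ)⁻¹ := by positivity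
    linarith

/-- `2! * e₂(1, 1/2, …, 1/n)`. -/
def harmonicTwo (n : ℕ) : ℚ := harmonic n ^ 2 - genHarmonic 2 n

/-- `3! * e₃(1, 1/2, …, 1/n)`. -/
def harmonicThree (n : ℕ) : ℚ :=
  harmonic n ^ 3 - 3 * harmonic n * genHarmonic 2 n + 2 * genHarmonic 3 n

/-- The recurrence of elementary symmetric functions when the variable `1 / (n + 1)` is adjoined;
its increment is visibly nonnegative, which the power-sum form hides. -/
theorem harmonicTwo_succ (n : ℕ) :
    harmonicTwo (n + 1) = harmonicTwo n + 2 * harmonic n / (n + 1) := by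
  simp only [harmonicTwo, genHarmonic_succ, harmonic_succ]
  push_cast
  field_simp
  ring

theorem harmonicThree_succ (n : ℕ) :
    harmonicThree (n + 1) = harmonicThree n + 3 * harmonicTwo n / (n + 1) := by
  simp only [harmonicThree, harmonicTwo, genHarmonic_succ, harmonic_succ]
  push_cast
  field_simp
  ring

theorem monotone_harmonicTwo : Monotone harmonicTwo :=
  monotone_nat_of_le_succ fun n => by
    have := harmonic_nonneg n
    rw [harmonicTwo_succ]
    exact le_add_of_nonneg_right (by positivity)

theorem harmonicTwo_nonneg (n : ℕ) : 0 ≤ harmonicTwo n := by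
  simpa [harmonicTwo, genHarmonic] using monotone_harmonicTwo n.zero_le

theorem monotone_harmonicThree : Monotone harmonicThree :=
  monotone_nat_of_le_succ fun n => by
    have := harmonicTwo_nonneg n
    rw [harmonicThree_succ]
    exact le_add_of_nonneg_right (by positivity)

theorem harmonicThree_nonneg (n : ℕ) : 0 ≤ harmonicThree n := by
  simpa [harmonicThree, genHarmonic] using monotone_harmonicThree n.zero_le

theorem monotone_ratCast {f : ℕ → ℚ} (hf : Monotone f) : Monotone fun n => (f n : ℝ) :=
  fun _ _ h => Rat.cast_le.mpr (hf h)

/-! ### The four formulas -/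

theorem zetaRegularPart_one : zetaRegularPart 1 = (Real.eulerMascheroniConstant : ℂ) := by
  rw [zetaRegularPart, Function.update_self, tendsto_riemannZeta_sub_one_div.limUnder_eq]

theorem mainTheorem3 :
    (∀ N : ℕ, ∃ θ : ℝ, 0 < θ ∧ θ < 1 ∧
      Real.eulerMascheroniConstant =
        1 / 2 * (1 + ∑ k ∈ Finset.Icc 1 N, (bernoulli (2 * k) : ℝ) / (k : ℝ)
          + θ * ((bernoulli (2 * N + 2) : ℝ) / ((N : ℝ) + 1)))) ∧
    (∀ N : ℕ, ∃ θ : ℝ, 0 < θ ∧ θ < 1 ∧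
      stieltjesConst 1 =
        ((-(1 / 2) * ∑ k ∈ Finset.Icc 1 N,
              (bernoulli (2 * k) : ℝ) * (harmonic (2 * k - 1) : ℝ) / (k : ℝ)
          - θ * ((bernoulli (2 * N + 2) : ℝ) * (harmonic (2 * N + 1) : ℝ)
              / (2 * (N : ℝ) + 2)) : ℝ) : ℂ)) ∧
    (∀ N : ℕ, 1 ≤ N → ∃ θ : ℝ, 0 < θ ∧ θ < 1 ∧
      stieltjesConst 2 =
        ((1 / 2 * ∑ k ∈ Finset.Icc 1 N,
              (bernoulli (2 * k) : ℝ) *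
                ((harmonic (2 * k - 1) : ℝ) ^ 2 - (genHarmonic 2 (2 * k - 1) : ℝ)) / (k : ℝ)
          + θ * ((bernoulli (2 * N + 2) : ℝ) *
                ((harmonic (2 * N + 1) : ℝ) ^ 2 - (genHarmonic 2 (2 * N + 1) : ℝ))
              / (2 * (N : ℝ) + 2)) : ℝ) : ℂ)) ∧
    (∀ N : ℕ, 1 ≤ N → ∃ θ : ℝ, 0 < θ ∧ θ < 1 ∧
      stieltjesConst 3 =
        ((-(1 / 2) * ∑ k ∈ Finset.Icc 1 N,
              (bernoulli (2 * k) : ℝ) *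
                ((harmonic (2 * k - 1) : ℝ) ^ 3
                  - 3 * (harmonic (2 * k - 1) : ℝ) * (genHarmonic 2 (2 * k - 1) : ℝ)
                  + 2 * (genHarmonic 3 (2 * k - 1) : ℝ)) / (k : ℝ)
          - θ * ((bernoulli (2 * N + 2) : ℝ) *
                ((harmonic (2 * N + 1) : ℝ) ^ 3
                  - 3 * (harmonic (2 * N + 1) : ℝ) * (genHarmonic 2 (2 * N + 1) : ℝ)
                  + 2 * (genHarmonic 3 (2 * N + 1) : ℝ))
              / (2 * (N : ℝ) + 2)) : ℝ) : ℂ)) := by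
  refine ⟨fun N => ?_, fun N => ?_, fun N hN => ?_, fun N hN => ?_⟩
  · obtain ⟨x, hx, hb⟩ := exists_real_iteratedDeriv_zetaRegularPart 0
    rw [iteratedDeriv_zero, zetaRegularPart_one] at hx
    -- At `a = 8` the error is at most `m! / (18 * 7 ^ 3) = m! / 6174`, small enough for every
    -- comparison with the first partial sums.
    obtain ⟨l, u⟩ := abs_le.mp (hb 8 (by norm_num))
    norm_num at l u
    have hb := emStieltjes_zero_bounds
    -- The shift by `1 / 2` absorbs the leading 1 in the braces of the formula for `γ`.
    obtain ⟨θ, h0, h1, h⟩ := exists_theta_of_bernoulli (Q := fun _ => 1) (x := x - 1 / 2) (N := N)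
      (fun _ => zero_le_one) monotone_const (by norm_num; linarith) (by norm_num; linarith)
      (by norm_num; linarith) (Or.inr (by linarith))
    refine ⟨θ, h0, h1, ?_⟩
    rw [Complex.ofReal_inj.mp hx]
    have hN : (N : ℝ) + 1 ≠ 0 := by positivity
    simp only [mul_one] at h ⊢
    rw [sub_eq_iff_eq_add.mp h]
    field_simp
    ring
  · obtain ⟨x, hx, hb⟩ := exists_real_iteratedDeriv_zetaRegularPart 1
    obtain ⟨l, u⟩ := abs_le.mp (hb 8 (by norm_num))
    norm_num at l u
    have hb := emStieltjes_one_bounds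
    obtain ⟨θ, h0, h1, h⟩ := exists_theta_of_bernoulli (Q := fun n => (harmonic n : ℝ)) (x := x)
      (N := N) (fun n => by exact_mod_cast harmonic_nonneg n) (monotone_ratCast monotone_harmonic)
      (by norm_num [harmonic, sum_range_succ]; linarith)
      (by norm_num [harmonic, sum_range_succ]; linarith)
      (by norm_num [harmonic, sum_range_succ]; linarith) (Or.inr (by linarith))
    refine ⟨θ, h0, h1, ?_⟩
    rw [stieltjesConst, hx, h]
    push_cast
    ring
  · obtain ⟨x, hx, hb⟩ := exists_real_iteratedDeriv_zetaRegularPart 2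
    obtain ⟨l, u⟩ := abs_le.mp (hb 8 (by norm_num))
    norm_num [Nat.factorial] at l u
    have hb := emStieltjes_two_bounds
    obtain ⟨θ, h0, h1, h⟩ := exists_theta_of_bernoulli (Q := fun n => (harmonicTwo n : ℝ)) (x := x)
      (N := N) (fun n => by exact_mod_cast harmonicTwo_nonneg n)
      (monotone_ratCast monotone_harmonicTwo)
      (by norm_num [harmonicTwo, harmonic, genHarmonic, sum_range_succ, sum_Icc_succ_top]; linarith)
      (by norm_num [harmonicTwo, harmonic, genHarmonic, sum_range_succ, sum_Icc_succ_top]; linarith)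
      (by norm_num [harmonicTwo, harmonic, genHarmonic, sum_range_succ, sum_Icc_succ_top]; linarith)
      -- Here `x < Q 1 / 12 = 0`, so only the alternative `1 ≤ N` is available; the same happens for
      -- `γ_3`.
      (Or.inl hN)
    refine ⟨θ, h0, h1, ?_⟩
    rw [stieltjesConst, hx, h]
    simp only [harmonicTwo]
    push_cast
    ring
  · obtain ⟨x, hx, hb⟩ := exists_real_iteratedDeriv_zetaRegularPart 3
    obtain ⟨l, u⟩ := abs_le.mp (hb 8 (by norm_num))
    norm_num [Nat.factorial] at l u
    have hb := emStieltjes_three_bounds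
    obtain ⟨θ, h0, h1, h⟩ := exists_theta_of_bernoulli (Q := fun n => (harmonicThree n : ℝ))
      (x := x) (N := N) (fun n => by exact_mod_cast harmonicThree_nonneg n)
      (monotone_ratCast monotone_harmonicThree)
      (by norm_num [harmonicThree, harmonic, genHarmonic, sum_range_succ, sum_Icc_succ_top]; linarith)
      (by norm_num [harmonicThree, harmonic, genHarmonic, sum_range_succ, sum_Icc_succ_top]; linarith)
      (by norm_num [harmonicThree, harmonic, genHarmonic, sum_range_succ, sum_Icc_succ_top]; linarith)
      (Or.inl hN)
    refine ⟨θ, h0, h1, ?_⟩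
    rw [stieltjesConst, hx, h]
    simp only [harmonicThree]
    push_cast
    ring
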